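/- Let $n\ge 1$. A permutation $\theta=a_1,a_2,\dots,a_{n+1}$ of $\{1,\dots,n+1\}$ (with $a_i=\theta(i)$) is \emph{indecomposable} if there is no $p$ with $1\le p<n+1$ such that $\theta$ maps $\{1,\dots,p\}$ into itself; a position $i$ carries a \emph{left-to-right maximum} of $\theta$ if $a_j<a_i$ for all $1\le j<i$. A \emph{hypermap} with darts $1,\dots,n$ is a pair $(\sigma,\alpha)$ of permutations of $\{1,\dots,n\}$ that generate a group acting transitively on $\{1,\dots,n\}$. A \emph{rooted hypermap} is an equivalence class of hypermaps, where $(\sigma,\alpha)$ and $(\sigma',\alpha')$ are equivalent if there is a permutation $\phi$ of $\{1,\dots,n\}$ with $\phi(n)=n$, $\phi^{-1}\sigma\phi=\sigma'$ and $\phi^{-1}\alpha\phi=\alpha'$. For an indecomposable permutation $\theta$ of $\{1,\dots,n+1\}$ let $1=i_1<i_2<\dots<i_k$ be the positions of its left-to-right maxima, and let $$\sigma_1=(1,2,\dots,i_2-1)(i_2,i_2+1,\dots,i_3-1)\cdots(i_k,i_k+1,\dots,n+1).$$ Let $\Psi(\theta)=(\sigma,\alpha)$, where $\sigma$ and $\alpha$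 are the permutations of $\{1,\dots,n\}$ obtained from $\sigma_1$ and $\theta$, respectively, by deleting $n+1$ from its cycle. **Theorem.** For every indecomposable permutation $\theta$ of $\{1,\dots,n+1\}$ the pair $\Psi(\theta)$ is a hypermap, and the map sending $\theta$ to the class of $\Psi(\theta)$ is a bijection from the set of indecomposable permutations of $\{1,\dots,n+1\}$ onto the set of rooted hypermaps with darts $1,\dots,n$. Moreover, for every indecomposable $\theta$, writing $(\sigma,\alpha)=\Psi(\theta)$, the permutations $\alpha$ and $\theta$ have the same number of cycles, and the number of cycles of $\sigma$ equals the number of left-to-right maxima of $\theta$ (fixed points count as cycles). -/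

import Mathlib

/-! Permutations of `{1, …, n}` are elements of `Equiv.Perm (Fin n)`: the number `i` of the usual
labelling is the element `i - 1` of `Fin n`.  Products satisfy `(α * β) i = α (β i)`. -/

namespace OMR

/-- `θ` is indecomposable: no initial interval `{1, …, p}` with `1 ≤ p < n` is mapped into
itself. -/
def Indecomposable {n : ℕ} (θ : Equiv.Perm (Fin n)) : Prop :=
  ¬ ∃ p : ℕ, 1 ≤ p ∧ p < n ∧ ∀ i : Fin n, (i : ℕ) < p → (θ i : ℕ) < p

/-- The position `i` carries a left-to-right maximum of the sequence `θ 1, θ 2, …`. -/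
def IsLRMax {n : ℕ} (θ : Equiv.Perm (Fin n)) (i : Fin n) : Prop :=
  ∀ j : Fin n, j < i → θ j < θ i

instance {n : ℕ} (θ : Equiv.Perm (Fin n)) : DecidablePred (IsLRMax θ) :=
  fun i => inferInstanceAs (Decidable (∀ j : Fin n, j < i → θ j < θ i))

/-- The number of left-to-right maxima of `θ`. -/
def numLRMax {n : ℕ} (θ : Equiv.Perm (Fin n)) : ℕ :=
  (Finset.univ.filter (fun i => IsLRMax θ i)).card

/-- The number of cycles of a permutation, fixed points included. -/
noncomputable def numCycles {n : ℕ} (π : Equiv.Perm (Fin n)) : ℕ :=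
  Nat.card (Quotient (Equiv.Perm.SameCycle.setoid π))

theorem isLRMax_zero {n : ℕ} (θ : Equiv.Perm (Fin (n + 1))) : IsLRMax θ 0 :=
  fun j hj => absurd hj (Fin.not_lt_zero j)

/-- The last position `i_p ≤ i` that carries a left-to-right maximum, that is, the first element
of the block `i_p, i_p + 1, …, i_{p+1} - 1` containing `i`. -/
def blockStart {n : ℕ} (θ : Equiv.Perm (Fin (n + 1))) (i : Fin (n + 1)) : Fin (n + 1) :=
  (Finset.univ.filter (fun p => IsLRMax θ p ∧ p ≤ i)).max'
    ⟨0, by simp [isLRMax_zero θ]⟩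

theorem isLRMax_blockStart {n : ℕ} (θ : Equiv.Perm (Fin (n + 1))) (i : Fin (n + 1)) :
    IsLRMax θ (blockStart θ i) ∧ blockStart θ i ≤ i := by
  have h := Finset.max'_mem (Finset.univ.filter (fun p => IsLRMax θ p ∧ p ≤ i))
    ⟨0, by simp [isLRMax_zero θ]⟩
  exact (Finset.mem_filter.mp h).2

theorem le_blockStart {n : ℕ} (θ : Equiv.Perm (Fin (n + 1))) {i p : Fin (n + 1)}
    (hp : IsLRMax θ p) (hpi : p ≤ i) : p ≤ blockStart θ i :=
  Finset.le_max' _ _ (Finset.mem_filter.mpr ⟨Finset.mem_univ p, hp, hpi⟩)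

/-- The map underlying `σ₁ = (1, …, i₂ - 1)(i₂, …, i₃ - 1) ⋯ (i_k, …, n + 1)`: the last element of
a block goes to the first element of that block, every other `i` goes to `i + 1`. -/
def sigmaOneFun {n : ℕ} (θ : Equiv.Perm (Fin (n + 1))) (i : Fin (n + 1)) : Fin (n + 1) :=
  if i = Fin.last n ∨ IsLRMax θ (i + 1) then blockStart θ i else i + 1

theorem sigmaOneFun_injective {n : ℕ} (θ : Equiv.Perm (Fin (n + 1))) :
    Function.Injective (sigmaOneFun θ) := by
  have key : ∀ i j : Fin (n + 1), i < j → (i = Fin.last n ∨ IsLRMax θ (i + 1)) →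
      blockStart θ i ≠ blockStart θ j := by
    intro i j hij hi heq
    have hne : i ≠ Fin.last n := Fin.ne_last_of_lt hij
    have hi1 := hi.resolve_left hne
    have h1 : i + 1 ≤ j := Fin.add_one_le_of_lt hij
    have h2 := le_blockStart θ hi1 h1
    have h3 := (isLRMax_blockStart θ i).2
    have h4 : i < i + 1 := Fin.lt_add_one_iff.mpr (Fin.lt_last_iff_ne_last.mpr hne)
    rw [← heq] at h2
    exact absurd (lt_of_lt_of_le h4 (h2.trans h3)) (lt_irrefl _)
  intro i j hij
  unfold sigmaOneFun at hij
  split_ifs at hij with h1 h2 h2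
  · rcases lt_trichotomy i j with h | h | h
    · exact absurd hij (key i j h h1)
    · exact h
    · exact absurd hij.symm (key j i h h2)
  · exact absurd (hij ▸ (isLRMax_blockStart θ i).1) (fun h => h2 (Or.inr h))
  · exact absurd (hij.symm ▸ (isLRMax_blockStart θ j).1) (fun h => h1 (Or.inr h))
  · exact add_right_cancel hij

/-- The permutation `σ₁` whose cycles are the intervals starting at the positions of the
left-to-right maxima of `θ`, each in increasing order. -/
noncomputable def sigmaOne {n : ℕ} (θ : Equiv.Perm (Fin (n + 1))) : Equiv.Perm (Fin (n + 1)) :=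
  Equiv.ofBijective (sigmaOneFun θ) (Finite.injective_iff_bijective.mp (sigmaOneFun_injective θ))

/-- Delete the largest element `n + 1` from its cycle. -/
def deleteLast {n : ℕ} (π : Equiv.Perm (Fin (n + 1))) : Equiv.Perm (Fin n) :=
  Equiv.removeNone ((finSuccEquivLast.symm.trans π).trans finSuccEquivLast)

/-- What `deleteLast` does: the preimage of `n + 1` is now sent to the image of `n + 1`, and all
other values are unchanged. -/
theorem castSucc_deleteLast {n : ℕ} (π : Equiv.Perm (Fin (n + 1))) (i : Fin n) :
    (deleteLast π i).castSucc =
      if π i.castSucc = Fin.last n then π (Fin.last n) else π i.castSucc := by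
  set e : Option (Fin n) ≃ Option (Fin n) :=
    (finSuccEquivLast.symm.trans π).trans finSuccEquivLast with he
  have hcs : ∀ x : Fin n, x.castSucc = finSuccEquivLast.symm (some x) := by simp
  have hl : Fin.last n = finSuccEquivLast.symm none := by simp
  have hval : ∀ o, π (finSuccEquivLast.symm o) = finSuccEquivLast.symm (e o) := by
    intro o; simp [he]
  rw [hcs, hcs i, hl, hval, hval]
  show finSuccEquivLast.symm (some (Equiv.removeNone e i)) = _
  split_ifs with h
  · rw [Equiv.removeNone_none e (finSuccEquivLast.symm.injective h)]
  · have h' : e (some i) ≠ none := fun h0 => h (congrArg _ h0)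
    obtain ⟨x, hx⟩ := Option.ne_none_iff_exists'.mp h'
    rw [Equiv.removeNone_some e ⟨x, hx⟩]

/-- A (labelled) hypermap on the darts `1, …, n`: a pair of permutations generating a transitive
group. -/
structure Hypermap (n : ℕ) where
  σ : Equiv.Perm (Fin n)
  α : Equiv.Perm (Fin n)
  transitive : MulAction.IsPretransitive (Subgroup.closure {σ, α} : Subgroup (Equiv.Perm (Fin n)))
    (Fin n)

/-- Isomorphism of rooted hypermaps: conjugacy by a permutation fixing the root, which is the
largest dart `n`. -/
def RootedIso {n : ℕ} (H H' : Hypermap n) : Prop :=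
  ∃ φ : Equiv.Perm (Fin n), φ⁻¹ * H.α * φ = H'.α ∧ φ⁻¹ * H.σ * φ = H'.σ ∧
    ∀ r : Fin n, (r : ℕ) + 1 = n → φ r = r

/-- Rooted isomorphism as an equivalence relation. -/
def rootedSetoid (n : ℕ) : Setoid (Hypermap n) where
  r := RootedIso
  iseqv :=
    { refl := fun H => ⟨1, by simp, by simp, by simp⟩
      symm := by
        rintro H H' ⟨φ, h1, h2, h3⟩
        refine ⟨φ⁻¹, ?_, ?_, ?_⟩
        · rw [← h1]; group
        · rw [← h2]; group
        · intro r hr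
          rw [Equiv.Perm.inv_eq_iff_eq, h3 r hr]
      trans := by
        rintro H H' H'' ⟨φ, h1, h2, h3⟩ ⟨ψ, k1, k2, k3⟩
        refine ⟨φ * ψ, ?_, ?_, ?_⟩
        · rw [← k1, ← h1]; group
        · rw [← k2, ← h2]; group
        · intro r hr
          rw [Equiv.Perm.mul_apply, k3 r hr, h3 r hr] }

/-- The set of rooted hypermaps with darts `1, …, n`. -/
def RootedHypermap (n : ℕ) : Type := Quotient (rootedSetoid n)

/-- The component `σ` of `Ψ(θ)`. -/
noncomputable def psiSigma {n : ℕ} (θ : Equiv.Perm (Fin (n + 1))) : Equiv.Perm (Fin n) :=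
  deleteLast (sigmaOne θ)

/-- The component `α` of `Ψ(θ)`. -/
def psiAlpha {n : ℕ} (θ : Equiv.Perm (Fin (n + 1))) : Equiv.Perm (Fin n) :=
  deleteLast θ

end OMR

namespace OMR

open Equiv

/-! Deletion is undone by inserting `n + 1` after `n` in `σ` and after `σ n` in `α`. A hypermap thus
becomes a transitive pair `(σ, θ)` on `n + 1` points with `θ (σ (n + 1)) = n + 1`. The bijection
amounts to this: such a pair has exactly one relabelling fixing `n + 1` that turns it into `(σ₁, θ)`
with `θ` indecomposable. `Canonical` characterises the pairs `(σ₁, θ)` one label at a time.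

The labels are forced downwards from `n + 1`. Suppose those above `m` are placed. If the
`σ`-preimage of `m + 1` is unlabelled, it must receive `m`. Otherwise the unlabelled points are
`σ`-stable, and by transitivity some `θ`-image among them is already labelled. The point with the
largest image has to start the block ending at `m`, so its `σ`-preimage receives `m`. See
`CanonicalFrom.exists_step` for existence and `eq_one_of_canonical` for uniqueness.

Insertion into a cycle keeps the number of cycles, and the cycles of `σ₁` are the blocks, one per
left-to-right maximum. -/

theorem perm_apply_inv_self {α : Type*} (π : Perm α) (x : α) : π (π⁻¹ x) = x :=
  π.apply_symm_apply x

theorem perm_inv_apply_self {α : Type*} (π : Perm α) (x : α) : π⁻¹ (π x) = x :=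
  π.symm_apply_apply x

/-! ### Transitivity in terms of stable subsets -/

/-- No proper nonempty subset is stable under both permutations. -/
def NoStableSubset {n : ℕ} (σ α : Perm (Fin n)) : Prop :=
  ∀ S : Set (Fin n), S.Nonempty → (∀ i ∈ S, σ i ∈ S) → (∀ i ∈ S, α i ∈ S) → ∀ j, j ∈ S

theorem inv_mem_of_stable {n : ℕ} {π : Perm (Fin n)} {S : Set (Fin n)} (h : ∀ i ∈ S, π i ∈ S) :
    ∀ i ∈ S, π⁻¹ i ∈ S :=
  Equiv.Perm.perm_symm_mapsTo_of_mapsTo π (s := S) h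

theorem isPretransitive_closure_pair_iff {n : ℕ} (σ α : Perm (Fin n)) :
    MulAction.IsPretransitive (Subgroup.closure {σ, α} : Subgroup (Perm (Fin n))) (Fin n) ↔
      NoStableSubset σ α := by
  constructor
  · intro h S hS h1 h2 j
    obtain ⟨i, hi⟩ := hS
    obtain ⟨g, hg⟩ := h.exists_smul_eq i j
    have key : ∀ g ∈ Subgroup.closure {σ, α}, ∀ i ∈ S, g i ∈ S := by
      intro g hg
      induction hg using Subgroup.closure_induction with
      | mem x hx =>
        rcases hx with rfl | rfl
        · exact h1
        · exact h2
      | one => simp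
      | mul x y _ _ hx hy => exact fun i hi => hx _ (hy _ hi)
      | inv x _ hx => exact inv_mem_of_stable hx
    rw [← hg]
    exact key g.1 g.2 i hi
  · intro h
    refine ⟨fun x y => ?_⟩
    have hmem : ∀ π ∈ ({σ, α} : Set (Perm (Fin n))),
        ∀ i ∈ MulAction.orbit (Subgroup.closure {σ, α} : Subgroup (Perm (Fin n))) x,
          π i ∈ MulAction.orbit (Subgroup.closure {σ, α} : Subgroup (Perm (Fin n))) x := by
      rintro π hπ i ⟨g, rfl⟩
      exact ⟨⟨π, Subgroup.subset_closure hπ⟩ * g, by simp [mul_smul]⟩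
    exact h (MulAction.orbit (Subgroup.closure {σ, α} : Subgroup (Perm (Fin n))) x)
      ⟨x, MulAction.mem_orbit_self x⟩ (hmem σ (by simp)) (hmem α (by simp)) y

/-! ### Canonically labelled pairs -/

/-- The condition that the label `m` has to satisfy in a canonically labelled pair. -/
def CanonicalAt {n : ℕ} (σ θ : Perm (Fin (n + 1))) (m : Fin (n + 1)) : Prop :=
  (σ m : ℕ) ≠ m + 1 → σ m ≤ m ∧ (m = Fin.last n ∨ m < θ (σ m)) ∧ ∀ j ≤ m, θ j ≤ θ (σ m)

/-- The pairs `(σ, θ)` with `θ` indecomposable and `σ = σ₁`: see `canonical_sigmaOne`,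
`Canonical.indecomposable` and `Canonical.sigma_eq`. -/
def Canonical {n : ℕ} (σ θ : Perm (Fin (n + 1))) : Prop := ∀ m, CanonicalAt σ θ m

/-- Successors are compared in `ℕ`, without wraparound, so the last label always ends a block, and
the start of that block dominates every value. -/
theorem Canonical.apply_sigma_last {n : ℕ} {σ θ : Perm (Fin (n + 1))} (h : Canonical σ θ) :
    θ (σ (Fin.last n)) = Fin.last n := by
  have := (h (Fin.last n) (by have := (σ (Fin.last n)).is_lt; simp; omega)).2.2
    (θ⁻¹ (Fin.last n)) (Fin.le_last _)
  rw [perm_apply_inv_self] at this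
  exact le_antisymm (Fin.le_last _) this

theorem Canonical.lt_apply_sigma {n : ℕ} {σ θ : Perm (Fin (n + 1))} (h : Canonical σ θ)
    {m : Fin (n + 1)} (hm : m ≠ Fin.last n) (hs : (σ m : ℕ) ≠ m + 1) : m < θ (σ m) :=
  (h m hs).2.1.resolve_left hm

theorem Canonical.eq_of_sigma_eq {n : ℕ} {σ θ : Perm (Fin (n + 1))} (h : Canonical σ θ)
    {m x : Fin (n + 1)} (hx : x ≤ m) (hs : (σ x : ℕ) = m + 1) : x = m := by
  by_contra hne
  have := (h x (by intro h'; apply hne; ext; omega)).1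
  rw [Fin.le_def] at *
  omega

/-- Otherwise this label would end a block whose start carries the largest value, which already
belongs to the start of the last block. -/
theorem Canonical.sigma_castSucc_last {n : ℕ} {σ θ : Perm (Fin (n + 2))} (h : Canonical σ θ) :
    σ (Fin.last n).castSucc = Fin.last (n + 1) := by
  have hne : (Fin.last n).castSucc ≠ Fin.last (n + 1) := (Fin.castSucc_lt_last _).ne
  by_contra hc
  have h1 := h.lt_apply_sigma hne (fun h' => hc (Fin.ext (by simpa using h')))
  have h2 : θ (σ (Fin.last n).castSucc) = Fin.last (n + 1) := by
    rw [Fin.lt_def] at h1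
    ext
    have := (θ (σ (Fin.last n).castSucc)).is_lt
    simp at h1 ⊢
    omega
  rw [← h.apply_sigma_last] at h2
  exact hne (σ.injective (θ.injective h2))

/-- Below the last label, either `σ` or `θ ∘ σ` moves a label up, so a nonempty stable set contains
the last label. Its complement is stable too and cannot also contain it. -/
theorem Canonical.noStableSubset {n : ℕ} {σ θ : Perm (Fin (n + 1))} (h : Canonical σ θ) :
    NoStableSubset σ θ := by
  have key : ∀ S : Set (Fin (n + 1)), S.Nonempty → (∀ i ∈ S, σ i ∈ S) → (∀ i ∈ S, θ i ∈ S) →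
      Fin.last n ∈ S := by
    intro S hS h1 h2
    obtain ⟨m, hm, hmax⟩ := S.exists_max_image id S.toFinite hS
    by_contra hl
    have hne : m ≠ Fin.last n := fun h' => hl (h' ▸ hm)
    have hle := hmax _ (h1 m hm)
    have hlt := h.lt_apply_sigma hne (by simp only [id, Fin.le_def] at hle; omega)
    exact absurd (hmax _ (h2 _ (h1 m hm))) (not_le.mpr hlt)
  intro S hS h1 h2 j
  by_contra hj
  refine key Sᶜ ⟨j, hj⟩ (fun i hi hs => hi ?_) (fun i hi hs => hi ?_) (key S hS h1 h2)
  · simpa using inv_mem_of_stable h1 _ hs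
  · simpa using inv_mem_of_stable h2 _ hs

theorem apply_le_apply_blockStart {n : ℕ} (θ : Perm (Fin (n + 1))) {m j : Fin (n + 1)}
    (hj : j ≤ m) : θ j ≤ θ (blockStart θ m) := by
  obtain ⟨p, hp, hmax⟩ := (Finset.Iic m).exists_max_image θ ⟨m, by simp⟩
  simp only [Finset.mem_Iic] at hp hmax
  have hLR : IsLRMax θ p := fun i hi =>
    lt_of_le_of_ne (hmax i (hi.le.trans hp)) (fun h => hi.ne (θ.injective h))
  refine (hmax j hj).trans ?_
  rcases (le_blockStart θ hLR hp).eq_or_lt with h | h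
  · rw [← h]
  · exact ((isLRMax_blockStart θ m).1 p h).le

theorem sigmaOne_apply {n : ℕ} (θ : Perm (Fin (n + 1))) (i : Fin (n + 1)) :
    sigmaOne θ i = if i = Fin.last n ∨ IsLRMax θ (i + 1) then blockStart θ i else i + 1 := rfl

theorem val_add_one_of_ne_last {n : ℕ} {i : Fin (n + 1)} (h : i ≠ Fin.last n) :
    ((i + 1 : Fin (n + 1)) : ℕ) = i + 1 :=
  Fin.val_add_one_of_lt (Fin.lt_last_iff_ne_last.mpr h)

theorem canonical_sigmaOne {n : ℕ} {θ : Perm (Fin (n + 1))} (h : Indecomposable θ) :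
    Canonical (sigmaOne θ) θ := by
  intro m hm
  have hs : sigmaOne θ m = blockStart θ m := by
    rw [sigmaOne_apply] at hm ⊢
    split_ifs at hm ⊢ with hc
    · rfl
    · exact absurd (val_add_one_of_ne_last fun h' => hc (Or.inl h')) hm
  rw [hs]
  refine ⟨(isLRMax_blockStart θ m).2, ?_, fun j hj => apply_le_apply_blockStart θ hj⟩
  by_contra! hc
  have hlt := Fin.lt_last_iff_ne_last.mpr hc.1
  rw [Fin.lt_def, Fin.val_last] at hlt
  -- If the block start has value at most `m`, then so do all positions up to `m`, and they form a
  -- stable interval of length `m + 1`.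
  refine h ⟨m + 1, by omega, by omega, fun i hi => ?_⟩
  have h1 := (apply_le_apply_blockStart θ (show i ≤ m by rw [Fin.le_def]; omega)).trans hc.2
  rw [Fin.le_def] at h1
  omega

theorem Canonical.exists_block {n : ℕ} {σ θ : Perm (Fin (n + 1))} (h : Canonical σ θ)
    (p : Fin (n + 1)) :
    ∃ m, p ≤ m ∧ (σ m : ℕ) ≠ m + 1 ∧ σ m ≤ p ∧ ∀ x, p ≤ x → x < m → (σ x : ℕ) = x + 1 := by
  obtain ⟨m, hm, hmin⟩ := (Finset.univ.filter
    (fun m : Fin (n + 1) => p ≤ m ∧ (σ m : ℕ) ≠ m + 1)).exists_min_image id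
    ⟨Fin.last n, by
      have := (σ (Fin.last n)).is_lt
      simp [Fin.le_last]
      omega⟩
  simp only [Finset.mem_filter, Finset.mem_univ, true_and, id] at hm hmin
  have hstep : ∀ x, p ≤ x → x < m → (σ x : ℕ) = x + 1 := by
    intro x hx hxm
    by_contra hc
    exact absurd (hmin x ⟨hx, hc⟩) (not_le.mpr hxm)
  refine ⟨m, hm.1, hm.2, ?_, hstep⟩
  -- If `p < σ m ≤ m`, then `σ m - 1` would be a second preimage of `σ m`.
  by_contra! hlt
  have hle := (h m hm.2).1
  rw [Fin.le_def] at hle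
  rw [Fin.lt_def] at hlt
  have hlm := m.is_lt
  have hx := hstep ⟨(σ m : ℕ) - 1, by omega⟩ (by rw [Fin.le_def]; simp only; omega)
    (by rw [Fin.lt_def]; simp only; omega)
  have hx' : (σ ⟨(σ m : ℕ) - 1, by omega⟩) = σ m := by ext; simp only at hx; omega
  have := congrArg Fin.val (σ.injective hx')
  simp only at this
  omega

/-- The block containing the last point of a stable interval starts inside the interval, but the
value at its start leaves it. -/
theorem Canonical.indecomposable {n : ℕ} {σ θ : Perm (Fin (n + 1))} (h : Canonical σ θ) :
    Indecomposable θ := by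
  rintro ⟨p, hp1, hp2, hp⟩
  obtain ⟨m, hpm, hm, hs, -⟩ := h.exists_block ⟨p - 1, by omega⟩
  have h1 := hp (σ m) (by rw [Fin.le_def] at hs; simp only at hs; omega)
  rw [Fin.le_def] at hpm
  rcases (h m hm).2.1 with h2 | h2
  · rw [h2, h.apply_sigma_last, Fin.val_last] at h1
    omega
  · rw [Fin.lt_def] at h2
    simp only at hpm
    omega

theorem Canonical.isLRMax_sigma {n : ℕ} {σ θ : Perm (Fin (n + 1))} (h : Canonical σ θ)
    {m : Fin (n + 1)} (hm : (σ m : ℕ) ≠ m + 1) : IsLRMax θ (σ m) := fun j hj =>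
  lt_of_le_of_ne ((h m hm).2.2 j (hj.le.trans (h m hm).1)) (fun h' => hj.ne (θ.injective h'))

theorem Canonical.isLRMax_iff {n : ℕ} {σ θ : Perm (Fin (n + 1))} (h : Canonical σ θ)
    {i p : Fin (n + 1)} (hp : (p : ℕ) = i + 1) : IsLRMax θ p ↔ (σ i : ℕ) ≠ i + 1 := by
  obtain ⟨m, hpm, hm, hs, hstep⟩ := h.exists_block p
  constructor
  · intro hL hi
    have hσ : σ i = p := Fin.ext (by omega)
    have hne : σ m ≠ p := by
      intro h'
      have := σ.injective (h'.trans hσ.symm)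
      rw [this, Fin.le_def] at hpm
      omega
    exact absurd ((h m hm).2.2 p hpm) (not_le.mpr (hL _ (lt_of_le_of_ne hs hne)))
  · intro hi
    suffices σ m = p by rw [← this]; exact h.isLRMax_sigma hm
    -- A start `σ m` before `p` would lie in a block ending at some `m' ≤ i`. Then `σ m` and `σ m'`
    -- dominate each other under `θ`, hence coincide.
    by_contra hne
    obtain ⟨m', hm1, hm2, hm3, hm4⟩ := h.exists_block (σ m)
    have hlt : (σ m : ℕ) < p := Fin.lt_def.mp (lt_of_le_of_ne hs hne)
    have hle : (m' : ℕ) ≤ i := by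
      by_contra! hc
      exact hi (hm4 i (by rw [Fin.le_def]; omega) (by rw [Fin.lt_def]; omega))
    have hsm' : σ m' ≠ σ m := by
      intro h'
      have := σ.injective h'
      rw [this] at hle
      rw [Fin.le_def] at hpm
      omega
    have h1 := (h m hm).2.2 (σ m') (by rw [Fin.le_def] at *; omega)
    have h2 := (h m' hm2).2.2 (σ m) hm1
    exact hsm' (θ.injective (le_antisymm h1 h2))

theorem Canonical.sigma_eq {n : ℕ} {σ θ : Perm (Fin (n + 1))} (h : Canonical σ θ) :
    σ = sigmaOne θ := by
  ext1 i
  rw [sigmaOne_apply]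
  have hlast : ∀ hi : i ≠ Fin.last n, IsLRMax θ (i + 1) ↔ (σ i : ℕ) ≠ i + 1 := fun hi =>
    h.isLRMax_iff (val_add_one_of_ne_last hi)
  split_ifs with hc
  · have hi : (σ i : ℕ) ≠ i + 1 := by
      by_cases hil : i = Fin.last n
      · have := (σ i).is_lt
        rw [hil] at this ⊢
        rw [Fin.val_last]
        omega
      · exact (hlast hil).1 (hc.resolve_left hil)
    apply le_antisymm (le_blockStart θ (h.isLRMax_sigma hi) (h i hi).1)
    by_contra! hlt
    exact absurd ((h i hi).2.2 _ (isLRMax_blockStart θ i).2)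
      (not_le.mpr ((isLRMax_blockStart θ i).1 _ hlt))
  · rw [not_or] at hc
    have := mt (hlast hc.1).2 hc.2
    rw [not_not] at this
    exact Fin.ext (this.trans (val_add_one_of_ne_last hc.1).symm)

/-! ### Uniqueness and existence of the canonical labelling -/

theorem apply_le_iff_of_fixed {n : ℕ} {φ : Perm (Fin n)} {k : ℕ}
    (hφ : ∀ j : Fin n, k ≤ j → φ j = j) {m : Fin n} (hm : k ≤ (m : ℕ) + 1) (j : Fin n) :
    φ j ≤ m ↔ j ≤ m := by
  by_cases hj : k ≤ j
  · rw [hφ j hj]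
  · have : ¬ k ≤ φ j := fun h' => hj (by rwa [φ.injective (hφ _ h')] at h')
    rw [Fin.le_def, Fin.le_def]
    omega

theorem inv_apply_of_fixed {n : ℕ} {φ : Perm (Fin n)} {k : ℕ}
    (hφ : ∀ j : Fin n, k ≤ j → φ j = j) : ∀ j : Fin n, k ≤ j → φ⁻¹ j = j := fun j hj => by
  rw [Perm.inv_eq_iff_eq, hφ j hj]

theorem apply_eq_of_canonical {n : ℕ} {σ σ' θ' φ : Perm (Fin (n + 1))}
    (h' : Canonical σ' θ') (hσ : ∀ i, φ (σ i) = σ' (φ i)) {m : Fin (n + 1)}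
    (hφ : ∀ j : Fin (n + 1), (m : ℕ) + 1 ≤ j → φ j = j) (hs : (σ m : ℕ) = m + 1) : φ m = m := by
  have h1 : φ (σ m) = σ m := hφ _ hs.ge
  have h2 : φ m ≤ m := (apply_le_iff_of_fixed hφ le_rfl m).2 le_rfl
  exact h'.eq_of_sigma_eq h2 (by rw [← hσ, h1, hs])

/-- The value `θ (σ m)` exceeds `m`, so `φ` fixes it. It is therefore a value of `θ'` at a position
up to `m`, where `θ' (σ' m)` is the maximum. -/
theorem apply_sigma_le_of_canonical {n : ℕ} {σ θ σ' θ' φ : Perm (Fin (n + 1))}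
    (h : Canonical σ θ) (h' : Canonical σ' θ')
    (hθ : ∀ i, φ (θ i) = θ' (φ i)) {m : Fin (n + 1)} (hml : m ≠ Fin.last n)
    (hφ : ∀ j : Fin (n + 1), (m : ℕ) + 1 ≤ j → φ j = j) (hs : (σ m : ℕ) ≠ m + 1)
    (hs' : (σ' m : ℕ) ≠ m + 1) :
    θ (σ m) = θ' (φ (σ m)) ∧ θ (σ m) ≤ θ' (σ' m) := by
  have h1 : φ (θ (σ m)) = θ (σ m) := hφ _ (Fin.lt_def.mp (h.lt_apply_sigma hml hs))
  have h2 : φ (σ m) ≤ m := (apply_le_iff_of_fixed hφ le_rfl _).2 (h m hs).1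
  rw [hθ] at h1
  exact ⟨h1.symm, h1 ▸ (h' m hs').2.2 _ h2⟩

theorem eq_one_of_canonical {n : ℕ} {σ θ σ' θ' φ : Perm (Fin (n + 1))}
    (h : Canonical σ θ) (h' : Canonical σ' θ') (hσ : ∀ i, φ (σ i) = σ' (φ i))
    (hθ : ∀ i, φ (θ i) = θ' (φ i)) (hφ : φ (Fin.last n) = Fin.last n) : φ = 1 := by
  have hσ' : ∀ i, φ⁻¹ (σ' i) = σ (φ⁻¹ i) := fun i => by
    rw [Perm.inv_eq_iff_eq, hσ, perm_apply_inv_self]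
  have hθ' : ∀ i, φ⁻¹ (θ' i) = θ (φ⁻¹ i) := fun i => by
    rw [Perm.inv_eq_iff_eq, hθ, perm_apply_inv_self]
  -- Downward induction on labels: `d` bounds the distance from the last one.
  have key : ∀ d : ℕ, ∀ m : Fin (n + 1), n ≤ m + d → φ m = m := by
    intro d
    induction d with
    | zero =>
      intro m hm
      rwa [show m = Fin.last n from Fin.ext (by have := m.is_lt; simp; omega)]
    | succ d ih =>
      intro m hm
      by_cases hml : m = Fin.last n
      · rwa [hml]
      have hfix : ∀ j : Fin (n + 1), (m : ℕ) + 1 ≤ j → φ j = j := fun j hj => ih j (by omega)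
      by_cases hs : (σ m : ℕ) = m + 1
      · exact apply_eq_of_canonical h' hσ hfix hs
      by_cases hs' : (σ' m : ℕ) = m + 1
      · rw [← Perm.inv_eq_iff_eq.mp
          (apply_eq_of_canonical h hσ' (inv_apply_of_fixed hfix) hs')]
      obtain ⟨e, l1⟩ := apply_sigma_le_of_canonical h h' hθ hml hfix hs hs'
      obtain ⟨-, l2⟩ := apply_sigma_le_of_canonical h' h hθ' hml (inv_apply_of_fixed hfix) hs' hs
      rw [← le_antisymm l2 l1] at e
      have := θ'.injective e
      rw [hσ] at this
      exact (σ'.injective this).symm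
  ext1 m
  exact key n m (by omega)

/-! ### Existence, by choosing labels downwards -/

theorem NoStableSubset.conj {n : ℕ} {σ θ : Perm (Fin n)} (h : NoStableSubset σ θ)
    (φ : Perm (Fin n)) : NoStableSubset (φ⁻¹ * σ * φ) (φ⁻¹ * θ * φ) := by
  intro S hS h1 h2 j
  have := h ((φ⁻¹ : Perm (Fin n)) ⁻¹' S) (by obtain ⟨i, hi⟩ := hS; exact ⟨φ i, by simpa using hi⟩)
    (fun i hi => by simpa using h1 _ hi) (fun i hi => by simpa using h2 _ hi) (φ j)
  simpa using this

/-- The labels from `k` on have been chosen canonically. -/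
def CanonicalFrom {n : ℕ} (k : ℕ) (σ θ : Perm (Fin (n + 1))) : Prop :=
  ∀ m : Fin (n + 1), k ≤ m → CanonicalAt σ θ m ∧ ∀ x ≤ m, (σ x : ℕ) = m + 1 → x = m

/-- Later relabelling below `k` does not spoil earlier choices: the labels and values compared with
`m ≥ k` are fixed, and the rest stay below `k`. -/
theorem CanonicalFrom.conj {n k : ℕ} {σ θ : Perm (Fin (n + 1))} (h : CanonicalFrom k σ θ)
    (hl : θ (σ (Fin.last n)) = Fin.last n) {φ : Perm (Fin (n + 1))}
    (hφ : ∀ j : Fin (n + 1), k ≤ j → φ j = j) : CanonicalFrom k (φ⁻¹ * σ * φ) (φ⁻¹ * θ * φ) := by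
  have hφ' := inv_apply_of_fixed hφ
  have hsucc : ∀ m x : Fin (n + 1), k ≤ m → (((φ⁻¹ x : Fin (n + 1)) : ℕ) = m + 1 ↔
      (x : ℕ) = m + 1) := by
    intro m x hm
    constructor
    · intro hx
      have := hφ (φ⁻¹ x) (by omega)
      rw [perm_apply_inv_self] at this
      rw [this, hx]
    · intro hx
      rw [hφ' x (by omega), hx]
  intro m hm
  obtain ⟨h1, h2⟩ := h m hm
  constructor
  · intro hs
    rw [Perm.mul_apply, Perm.mul_apply, hφ m hm] at hs ⊢
    rw [Perm.mul_apply, Perm.mul_apply, perm_apply_inv_self]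
    obtain ⟨a, b, c⟩ := h1 (mt (hsucc m _ hm).2 hs)
    have hv : k ≤ (θ (σ m) : ℕ) := by
      rcases b with b | b
      · rw [b] at hm
        rw [b, hl]
        exact hm
      · exact hm.trans (Fin.lt_def.mp b).le
    rw [hφ' _ hv]
    refine ⟨(apply_le_iff_of_fixed hφ' (by omega) _).2 a, b, fun j hj => ?_⟩
    exact (apply_le_iff_of_fixed hφ' (by omega) _).2
      (c _ ((apply_le_iff_of_fixed hφ (by omega) _).2 hj))
  · intro x hx hs
    simp only [Perm.mul_apply] at hs
    have := h2 (φ x) ((apply_le_iff_of_fixed hφ (by omega) _).2 hx) ((hsucc m _ hm).1 hs)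
    rw [← hφ m hm] at this
    exact φ.injective this

theorem CanonicalFrom.exists_step {n : ℕ} {σ θ : Perm (Fin (n + 1))} {m : Fin (n + 1)}
    (hm : m ≠ Fin.last n) (h : CanonicalFrom (m + 1) σ θ) (ht : NoStableSubset σ θ)
    (hl : θ (σ (Fin.last n)) = Fin.last n) :
    ∃ φ : Perm (Fin (n + 1)), (∀ j : Fin (n + 1), (m : ℕ) + 1 ≤ j → φ j = j) ∧
      CanonicalFrom m (φ⁻¹ * σ * φ) (φ⁻¹ * θ * φ) := by
  have hlt : (m : ℕ) < n := by simpa [Fin.lt_def] using Fin.lt_last_iff_ne_last.mpr hm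
  have hswap : ∀ y ≤ m, ∀ j : Fin (n + 1), (m : ℕ) + 1 ≤ j → swap m y j = j := by
    intro y hy j hj
    rw [Fin.le_def] at hy
    exact swap_apply_of_ne_of_ne (by rintro rfl; omega) (by rintro rfl; omega)
  suffices ∃ y ≤ m, CanonicalAt ((swap m y)⁻¹ * σ * swap m y) ((swap m y)⁻¹ * θ * swap m y) m ∧
      ∀ x ≤ m, ((((swap m y)⁻¹ * σ * swap m y) x : Fin (n + 1)) : ℕ) = m + 1 → x = m by
    obtain ⟨y, hy, h1⟩ := this
    refine ⟨swap m y, hswap y hy, fun p hp => ?_⟩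
    rcases hp.eq_or_lt with e | hp'
    · rwa [← Fin.ext e]
    · exact h.conj hl (hswap y hy) p hp'
  obtain ⟨q, hq⟩ : ∃ q : Fin (n + 1), (q : ℕ) = m + 1 := ⟨⟨m + 1, by omega⟩, rfl⟩
  by_cases hx : σ⁻¹ q ≤ m
  · have hval : ((swap m (σ⁻¹ q))⁻¹ * σ * swap m (σ⁻¹ q)) m = q := by
      rw [Perm.mul_apply, Perm.mul_apply, swap_apply_left, perm_apply_inv_self]
      exact inv_apply_of_fixed (hswap _ hx) q hq.ge
    refine ⟨σ⁻¹ q, hx, fun hs => absurd (by rw [hval, hq]) hs, fun x _ hs => ?_⟩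
    rw [← hq] at hs
    exact ((swap m (σ⁻¹ q))⁻¹ * σ * swap m (σ⁻¹ q)).injective ((Fin.ext hs).trans hval.symm)
  -- This uses the second clause of `CanonicalFrom`: a label above `m + 1` cannot have its
  -- `σ`-preimage among the unlabelled points.
  · have hcl : ∀ x ≤ m, σ x ≤ m := by
      intro x hxm
      by_contra! hc
      rw [Fin.lt_def] at hc
      have hb := (σ x).is_lt
      by_cases e : σ x = q
      · rw [← e, perm_inv_apply_self] at hx
        exact hx hxm
      · have hne : (σ x : ℕ) ≠ m + 1 := fun h' => e (Fin.ext (h'.trans hq.symm))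
        rw [Fin.le_def] at hxm
        have := (h ⟨(σ x : ℕ) - 1, by omega⟩ (by simp only; omega)).2 x
          (by rw [Fin.le_def]; simp only; omega) (by simp only; omega)
        have := congrArg Fin.val this
        simp only at this
        omega
    have hcl' : ∀ x ≤ m, σ⁻¹ x ≤ m := inv_mem_of_stable (S := Set.Iic m) hcl
    -- The point `j` will start the new block, so `σ⁻¹ j` must end it and receive the label `m`.
    obtain ⟨j, hj, hmax⟩ := (Finset.Iic m).exists_max_image θ ⟨m, by simp⟩
    simp only [Finset.mem_Iic] at hj hmax
    have hv : m < θ j := by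
      by_contra! hc
      have := ht (Set.Iic m) ⟨m, le_refl m⟩ hcl (fun i hi => (hmax i hi).trans hc) (Fin.last n)
      rw [Set.mem_Iic, Fin.le_def, Fin.val_last] at this
      omega
    have hy := hcl' j hj
    have hfix := hswap _ hy
    have hfix' := inv_apply_of_fixed hfix
    refine ⟨σ⁻¹ j, hy, fun _ => ?_, fun x hxm hs => ?_⟩
    · simp only [Perm.mul_apply, swap_apply_left]
      rw [perm_apply_inv_self, perm_apply_inv_self, hfix' _ (Fin.lt_def.mp hv)]
      refine ⟨(apply_le_iff_of_fixed hfix' le_rfl _).2 hj, Or.inr hv, fun i hi => ?_⟩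
      rw [Fin.lt_def] at hv
      exact (apply_le_iff_of_fixed hfix' (by omega) _).2
        (hmax _ ((apply_le_iff_of_fixed hfix le_rfl _).2 hi))
    · have := (apply_le_iff_of_fixed hfix' le_rfl _).2
        (hcl _ ((apply_le_iff_of_fixed hfix le_rfl _).2 hxm))
      simp only [Perm.mul_apply] at hs
      rw [Fin.le_def] at this
      omega

theorem CanonicalFrom.exists_canonical {n : ℕ} (k : ℕ) (hk : k ≤ n) :
    ∀ {σ θ : Perm (Fin (n + 1))}, CanonicalFrom k σ θ → NoStableSubset σ θ →
      θ (σ (Fin.last n)) = Fin.last n → ∃ φ : Perm (Fin (n + 1)), φ (Fin.last n) = Fin.last n ∧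
        Canonical (φ⁻¹ * σ * φ) (φ⁻¹ * θ * φ) := by
  induction k with
  | zero => exact fun h _ _ => ⟨1, rfl, by simpa using! fun m => (h m (Nat.zero_le _)).1⟩
  | succ k ih =>
    intro σ θ h ht hl
    obtain ⟨φ, hφ, h1⟩ := CanonicalFrom.exists_step (m := ⟨k, by omega⟩)
      (by simp [Fin.ext_iff]; omega) h ht hl
    have hφl : φ (Fin.last n) = Fin.last n := hφ _ (by simpa using hk)
    have hφl' : φ⁻¹ (Fin.last n) = Fin.last n := by rw [Perm.inv_eq_iff_eq, hφl]
    obtain ⟨ψ, hψ, h2⟩ := ih (by omega) h1 (ht.conj φ) (by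
      rw [Perm.mul_apply, Perm.mul_apply, Perm.mul_apply, Perm.mul_apply, perm_apply_inv_self,
        hφl, hl, hφl'])
    refine ⟨φ * ψ, by simp [hψ, hφl], ?_⟩
    simpa [mul_assoc] using h2

theorem NoStableSubset.exists_canonical {n : ℕ} {σ θ : Perm (Fin (n + 1))}
    (ht : NoStableSubset σ θ) (hl : θ (σ (Fin.last n)) = Fin.last n) :
    ∃ φ : Perm (Fin (n + 1)), φ (Fin.last n) = Fin.last n ∧
      Canonical (φ⁻¹ * σ * φ) (φ⁻¹ * θ * φ) := by
  refine CanonicalFrom.exists_canonical n le_rfl (fun m hm => ?_) ht hl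
  obtain rfl : m = Fin.last n := Fin.ext (by have := m.is_lt; simp; omega)
  refine ⟨fun _ => ⟨Fin.le_last _, Or.inl rfl, fun j _ => hl.symm ▸ Fin.le_last _⟩,
    fun x _ hs => ?_⟩
  have := (σ x).is_lt
  simp at hs
  omega

/-! ### Inserting the largest element -/

/-- Extend a permutation by the fixed point `n + 1`. -/
def extendLast {n : ℕ} (π : Perm (Fin n)) : Perm (Fin (n + 1)) :=
  (finSuccEquivLast.trans (optionCongr π)).trans finSuccEquivLast.symm

@[simp] theorem extendLast_castSucc {n : ℕ} (π : Perm (Fin n)) (i : Fin n) :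
    extendLast π i.castSucc = (π i).castSucc := by simp [extendLast]

@[simp] theorem extendLast_last {n : ℕ} (π : Perm (Fin n)) :
    extendLast π (Fin.last n) = Fin.last n := by simp [extendLast]

theorem perm_ext_castSucc {n : ℕ} {π π' : Perm (Fin (n + 1))}
    (h : ∀ i : Fin n, π i.castSucc = π' i.castSucc) (hl : π (Fin.last n) = π' (Fin.last n)) :
    π = π' := by
  ext1 i
  induction i using Fin.lastCases with
  | last => exact hl
  | cast i => exact h i

theorem extendLast_mul {n : ℕ} (π π' : Perm (Fin n)) :
    extendLast (π * π') = extendLast π * extendLast π' :=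
  perm_ext_castSucc (by simp) (by simp)

theorem extendLast_inv {n : ℕ} (π : Perm (Fin n)) : extendLast π⁻¹ = (extendLast π)⁻¹ := by
  rw [eq_inv_iff_mul_eq_one, ← extendLast_mul, inv_mul_cancel]
  exact perm_ext_castSucc (by simp [extendLast]) (by simp)

/-- Insert `n + 1` into the cycle of `x`, right after `x`. -/
def insertLast {n : ℕ} (π : Perm (Fin n)) (x : Fin n) : Perm (Fin (n + 1)) :=
  extendLast π * swap x.castSucc (Fin.last n)

theorem insertLast_self {n : ℕ} (π : Perm (Fin n)) (x : Fin n) :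
    insertLast π x x.castSucc = Fin.last n := by simp [insertLast]

theorem insertLast_last {n : ℕ} (π : Perm (Fin n)) (x : Fin n) :
    insertLast π x (Fin.last n) = (π x).castSucc := by simp [insertLast]

theorem insertLast_of_ne {n : ℕ} (π : Perm (Fin n)) {x i : Fin n} (h : i ≠ x) :
    insertLast π x i.castSucc = (π i).castSucc := by
  rw [insertLast, Perm.mul_apply, swap_apply_of_ne_of_ne (by simpa using h)
    (Fin.castSucc_lt_last i).ne, extendLast_castSucc]

theorem deleteLast_insertLast {n : ℕ} (π : Perm (Fin n)) (x : Fin n) :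
    deleteLast (insertLast π x) = π := by
  ext1 i
  apply Fin.castSucc_injective
  rw [castSucc_deleteLast]
  by_cases h : i = x
  · rw [h, insertLast_self, if_pos rfl, insertLast_last]
  · rw [insertLast_of_ne π h, if_neg (Fin.castSucc_lt_last _).ne]

theorem insertLast_deleteLast {n : ℕ} {π : Perm (Fin (n + 1))} {x : Fin n}
    (hx : π x.castSucc = Fin.last n) : insertLast (deleteLast π) x = π := by
  refine perm_ext_castSucc (fun i => ?_) ?_
  · by_cases h : i = x
    · rw [h, insertLast_self, hx]
    · rw [insertLast_of_ne _ h, castSucc_deleteLast, if_neg]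
      intro h'
      exact h (Fin.castSucc_injective _ (π.injective (h'.trans hx.symm)))
  · rw [insertLast_last, castSucc_deleteLast, if_pos hx]

theorem extendLast_deleteLast {n : ℕ} {π : Perm (Fin (n + 1))} (h : π (Fin.last n) = Fin.last n) :
    extendLast (deleteLast π) = π := by
  refine perm_ext_castSucc (fun i => ?_) (by simp [h])
  rw [extendLast_castSucc, castSucc_deleteLast, if_neg]
  intro h'
  exact (Fin.castSucc_lt_last i).ne (π.injective (h'.trans h.symm))

theorem insertLast_conj {n : ℕ} (π φ : Perm (Fin n)) (x : Fin n) :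
    insertLast (φ⁻¹ * π * φ) x = (extendLast φ)⁻¹ * insertLast π (φ x) * extendLast φ := by
  rw [insertLast, insertLast, extendLast_mul, extendLast_mul, extendLast_inv,
    mul_assoc _ _ (swap _ _),
    mul_swap_eq_swap_mul]
  simp [mul_assoc]

theorem NoStableSubset.insertLast {n : ℕ} {σ α : Perm (Fin n)} (h : NoStableSubset σ α)
    (x y : Fin n) : NoStableSubset (insertLast σ x) (insertLast α y) := by
  intro S hS h1 h2
  have hdel : ∀ (π : Perm (Fin n)) (x : Fin n), (∀ i ∈ S, OMR.insertLast π x i ∈ S) →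
      ∀ i ∈ Fin.castSucc ⁻¹' S, π i ∈ Fin.castSucc ⁻¹' S := by
    intro π x hπ i hi
    by_cases e : i = x
    · have := hπ _ (hπ _ hi)
      rwa [e, insertLast_self, insertLast_last, ← e] at this
    · have := hπ _ hi
      rwa [insertLast_of_ne _ e] at this
  have hne : (Fin.castSucc ⁻¹' S).Nonempty := by
    obtain ⟨i, hi⟩ := hS
    induction i using Fin.lastCases with
    | last =>
      have := h1 _ hi
      rw [insertLast_last] at this
      exact ⟨_, this⟩
    | cast i => exact ⟨i, hi⟩
  have hall := h _ hne (hdel σ x h1) (hdel α y h2)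
  intro j
  induction j using Fin.lastCases with
  | last =>
    have := h1 _ (hall x)
    rwa [insertLast_self] at this
  | cast j => exact hall j

/-- A stable set is extended by the new point exactly when it contains `x`. This serves both
permutations, since `x` and `σ x` belong to it together. -/
theorem NoStableSubset.of_insertLast {n : ℕ} {σ α : Perm (Fin n)} {x : Fin n}
    (h : NoStableSubset (OMR.insertLast σ x) (OMR.insertLast α (σ x))) : NoStableSubset σ α := by
  intro T hT h1 h2
  have hmem : ∀ i, i.castSucc ∈ Fin.castSucc '' T ∪ {z | z = Fin.last n ∧ x ∈ T} ↔ i ∈ T := by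
    intro i
    simp [(Fin.castSucc_lt_last i).ne]
  have hlast : Fin.last n ∈ Fin.castSucc '' T ∪ {z | z = Fin.last n ∧ x ∈ T} ↔ x ∈ T := by
    simp [(Fin.castSucc_lt_last _).ne]
  have hins : ∀ (π : Perm (Fin n)) (y : Fin n), (∀ i ∈ T, π i ∈ T) → (y ∈ T ↔ x ∈ T) →
      ∀ i ∈ Fin.castSucc '' T ∪ {z | z = Fin.last n ∧ x ∈ T},
        OMR.insertLast π y i ∈ Fin.castSucc '' T ∪ {z | z = Fin.last n ∧ x ∈ T} := by
    intro π y hπ hy i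
    induction i using Fin.lastCases with
    | last =>
      rw [hlast, insertLast_last, hmem]
      exact fun hx => hπ _ (hy.2 hx)
    | cast i =>
      rw [hmem]
      intro hi
      by_cases e : i = y
      · rw [e, insertLast_self, hlast, ← hy, ← e]
        exact hi
      · rw [insertLast_of_ne _ e, hmem]
        exact hπ i hi
  obtain ⟨t, ht⟩ := hT
  have hx : σ x ∈ T ↔ x ∈ T :=
    ⟨fun h' => by simpa using inv_mem_of_stable h1 _ h', h1 x⟩
  intro j
  rw [← hmem]
  exact h _ ⟨t.castSucc, (hmem t).2 ht⟩ (hins σ x h1 Iff.rfl) (hins α (σ x) h2 hx) _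

/-! ### Counting cycles -/

theorem apply_eq_of_sameCycle {n : ℕ} {β : Type*} {π : Perm (Fin n)} {f : Fin n → β}
    (hf : ∀ x, f (π x) = f x) {x y : Fin n} (h : π.SameCycle x y) : f x = f y := by
  obtain ⟨k, rfl⟩ := h.exists_nat_pow_eq
  clear h
  induction k with
  | zero => rfl
  | succ k ih => rw [pow_succ', Perm.mul_apply, hf, ih]

theorem numCycles_eq_card {n : ℕ} {β : Type*} {π : Perm (Fin n)} (f : Fin n → β) (g : β → Fin n)
    (hf : ∀ x, f (π x) = f x) (hfg : ∀ b, f (g b) = b) (hgf : ∀ x, π.SameCycle (g (f x)) x) :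
    numCycles π = Nat.card β :=
  Nat.card_congr
    { toFun := Quotient.lift f fun _ _ h => apply_eq_of_sameCycle hf h
      invFun := fun b => Quotient.mk _ (g b)
      left_inv := by
        rintro ⟨x⟩
        exact Quotient.sound (hgf x)
      right_inv := hfg }

theorem numCycles_insertLast {n : ℕ} (π : Perm (Fin n)) (x : Fin n) :
    numCycles (insertLast π x) = numCycles π := by
  let q : Fin n → Quotient (Perm.SameCycle.setoid π) := Quotient.mk _
  have hq : ∀ i, q (π i) = q i := fun i =>
    Quotient.sound (Perm.sameCycle_apply_left.2 (Perm.SameCycle.refl π i))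
  have hstep : ∀ i, (insertLast π x).SameCycle (π i).castSucc i.castSucc := by
    intro i
    by_cases h : i = x
    · rw [h, ← insertLast_last π x, Perm.sameCycle_apply_left, ← insertLast_self π x,
        Perm.sameCycle_apply_left]
    · rw [← insertLast_of_ne π h, Perm.sameCycle_apply_left]
  have hsame : ∀ i j, π.SameCycle i j → (insertLast π x).SameCycle i.castSucc j.castSucc := by
    intro i j h
    have := apply_eq_of_sameCycle
      (f := fun i => (Quotient.mk (Perm.SameCycle.setoid (insertLast π x)) i.castSucc))
      (fun i => Quotient.sound (hstep i)) h
    exact Quotient.exact this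
  -- The new point is assigned the old cycle of `x`.
  refine numCycles_eq_card (Fin.lastCases (q x) q) (fun c => (Quotient.out c).castSucc) ?_ ?_ ?_
  · intro i
    induction i using Fin.lastCases with
    | last => rw [insertLast_last]; simp [hq]
    | cast i =>
      by_cases h : i = x
      · rw [h, insertLast_self]; simp
      · rw [insertLast_of_ne _ h]; simp [hq]
  · intro b
    simp [q]
  · have hout : ∀ i, (insertLast π x).SameCycle (Quotient.out (q i)).castSucc i.castSucc :=
      fun i => hsame _ _ (Quotient.exact (Quotient.out_eq (q i)))
    intro i
    induction i using Fin.lastCases with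
    | last =>
      rw [Fin.lastCases_last]
      refine (hout x).trans ?_
      rw [← insertLast_self π x, Perm.sameCycle_apply_right]
    | cast i =>
      rw [Fin.lastCases_castSucc]
      exact hout i

theorem blockStart_eq_self {n : ℕ} {θ : Perm (Fin (n + 1))} {i : Fin (n + 1)} (h : IsLRMax θ i) :
    blockStart θ i = i :=
  le_antisymm (isLRMax_blockStart θ i).2 (le_blockStart θ h le_rfl)

theorem blockStart_succ {n : ℕ} {θ : Perm (Fin (n + 1))} {i p : Fin (n + 1)}
    (hp : (p : ℕ) = i + 1) (h : ¬ IsLRMax θ p) : blockStart θ p = blockStart θ i := by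
  obtain ⟨h1, h2⟩ := isLRMax_blockStart θ p
  obtain ⟨h3, h4⟩ := isLRMax_blockStart θ i
  have hne : blockStart θ p ≠ p := fun e => h (e ▸ h1)
  have hlt := Fin.lt_def.mp (lt_of_le_of_ne h2 hne)
  refine le_antisymm (le_blockStart θ h1 ?_) (le_blockStart θ h3 (h4.trans ?_)) <;>
  · rw [Fin.le_def]
    omega

theorem sameCycle_blockStart {n : ℕ} (θ : Perm (Fin (n + 1))) (i : Fin (n + 1)) :
    (sigmaOne θ).SameCycle (blockStart θ i) i := by
  induction i using Fin.induction with
  | zero => rw [blockStart_eq_self (isLRMax_zero θ)]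
  | succ i ih =>
    by_cases h : IsLRMax θ i.succ
    · rw [blockStart_eq_self h]
    · have hs : i.castSucc + 1 = i.succ := by simp
      have : sigmaOne θ i.castSucc = i.succ := by
        rw [sigmaOne_apply, hs, if_neg (by simp [h, (Fin.castSucc_lt_last i).ne])]
      rw [blockStart_succ (i := i.castSucc) (by simp) h, ← this, Perm.sameCycle_apply_right]
      exact ih

theorem numCycles_sigmaOne {n : ℕ} (θ : Perm (Fin (n + 1))) :
    numCycles (sigmaOne θ) = numLRMax θ := by
  rw [numLRMax, ← Fintype.card_subtype, ← Nat.card_eq_fintype_card]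
  refine numCycles_eq_card (fun i => ⟨blockStart θ i, (isLRMax_blockStart θ i).1⟩) Subtype.val
    (fun i => ?_) (fun b => Subtype.ext (blockStart_eq_self b.2)) (sameCycle_blockStart θ)
  apply Subtype.ext
  show blockStart θ (sigmaOne θ i) = blockStart θ i
  rw [sigmaOne_apply]
  split_ifs with hc
  · exact blockStart_eq_self (isLRMax_blockStart θ i).1
  · rw [not_or] at hc
    exact blockStart_succ (val_add_one_of_ne_last hc.1) hc.2

/-! ### The bijection -/

theorem insertLast_psiSigma {n : ℕ} {θ : Perm (Fin (n + 2))} (h : Indecomposable θ) :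
    insertLast (psiSigma θ) (Fin.last n) = sigmaOne θ :=
  insertLast_deleteLast (canonical_sigmaOne h).sigma_castSucc_last

theorem insertLast_psiAlpha {n : ℕ} {θ : Perm (Fin (n + 2))} (h : Indecomposable θ) :
    insertLast (psiAlpha θ) (psiSigma θ (Fin.last n)) = θ := by
  apply insertLast_deleteLast
  rw [← insertLast_last, insertLast_psiSigma h]
  exact (canonical_sigmaOne h).apply_sigma_last

theorem noStableSubset_psi {n : ℕ} {θ : Perm (Fin (n + 2))} (h : Indecomposable θ) :
    NoStableSubset (psiSigma θ) (psiAlpha θ) := by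
  apply NoStableSubset.of_insertLast (x := Fin.last n)
  rw [insertLast_psiSigma h, insertLast_psiAlpha h]
  exact (canonical_sigmaOne h).noStableSubset

/-- Insertion commutes with relabellings fixing the root, so `φ` lifts to an isomorphism of
canonical pairs, which must be trivial. -/
theorem eq_of_psi_conj {n : ℕ} {θ θ' : Perm (Fin (n + 2))} (h : Indecomposable θ)
    (h' : Indecomposable θ') {φ : Perm (Fin (n + 1))} (hα : φ⁻¹ * psiAlpha θ * φ = psiAlpha θ')
    (hσ : φ⁻¹ * psiSigma θ * φ = psiSigma θ') (hφ : φ (Fin.last n) = Fin.last n) : θ = θ' := by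
  have e1 : sigmaOne θ' = (extendLast φ)⁻¹ * sigmaOne θ * extendLast φ := by
    rw [← insertLast_psiSigma h', ← hσ, insertLast_conj, hφ, insertLast_psiSigma h]
  have e2 : θ' = (extendLast φ)⁻¹ * θ * extendLast φ := by
    have hx : φ (psiSigma θ' (Fin.last n)) = psiSigma θ (Fin.last n) := by simp [← hσ, hφ]
    rw [← insertLast_psiAlpha h', ← hα, insertLast_conj, hx, insertLast_psiAlpha h]
  have hone : extendLast φ = 1 := by
    refine eq_one_of_canonical (canonical_sigmaOne h') (canonical_sigmaOne h) (fun i => ?_)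
      (fun i => ?_) (extendLast_last φ)
    · rw [e1]; simp
    · conv_lhs => rw [e2]
      simp
  rw [e2, hone]
  simp

theorem exists_indecomposable_conj {n : ℕ} {σ α : Perm (Fin (n + 1))} (h : NoStableSubset σ α) :
    ∃ θ : Perm (Fin (n + 2)), Indecomposable θ ∧ ∃ φ : Perm (Fin (n + 1)),
      φ (Fin.last n) = Fin.last n ∧ psiSigma θ = φ⁻¹ * σ * φ ∧ psiAlpha θ = φ⁻¹ * α * φ := by
  obtain ⟨ψ, hψ, hc⟩ := (h.insertLast (Fin.last n) (σ (Fin.last n))).exists_canonical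
    (by rw [insertLast_last, insertLast_self])
  obtain ⟨φ, rfl⟩ : ∃ φ, extendLast φ = ψ := ⟨_, extendLast_deleteLast hψ⟩
  -- Both before and after relabelling the root is the `σ`-preimage of the inserted point, so it is
  -- fixed as well.
  have hφ : φ (Fin.last n) = Fin.last n := by
    have := hc.sigma_castSucc_last
    rw [Perm.mul_apply, Perm.mul_apply, Perm.inv_eq_iff_eq, extendLast_last,
      ← insertLast_self σ (Fin.last n), extendLast_castSucc] at this
    exact Fin.castSucc_injective _ ((insertLast σ (Fin.last n)).injective this)
  refine ⟨_, hc.indecomposable, φ, hφ, ?_, ?_⟩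
  · rw [psiSigma, ← hc.sigma_eq]
    conv_lhs => rw [← hφ, ← insertLast_conj, deleteLast_insertLast]
  · have hx : σ (Fin.last n) = φ (φ⁻¹ (σ (Fin.last n))) := by simp
    rw [psiAlpha, hx, ← insertLast_conj, deleteLast_insertLast]

end OMR

theorem theorem1 (n : ℕ) (hn : 1 ≤ n) :
    (∃ hΨ : ∀ θ : Equiv.Perm (Fin (n + 1)), OMR.Indecomposable θ →
        MulAction.IsPretransitive
          (Subgroup.closure {OMR.psiSigma θ, OMR.psiAlpha θ} : Subgroup (Equiv.Perm (Fin n)))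
          (Fin n),
      Function.Bijective
        (fun θ : {θ : Equiv.Perm (Fin (n + 1)) // OMR.Indecomposable θ} =>
          (Quotient.mk (OMR.rootedSetoid n)
            ⟨OMR.psiSigma θ.1, OMR.psiAlpha θ.1, hΨ θ.1 θ.2⟩ : OMR.RootedHypermap n))) ∧
    ∀ θ : Equiv.Perm (Fin (n + 1)), OMR.Indecomposable θ →
      OMR.numCycles (OMR.psiAlpha θ) = OMR.numCycles θ ∧
      OMR.numCycles (OMR.psiSigma θ) = OMR.numLRMax θ := by
  obtain ⟨k, rfl⟩ : ∃ k, n = k + 1 := ⟨n - 1, by omega⟩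
  refine ⟨⟨fun θ hθ => (OMR.isPretransitive_closure_pair_iff _ _).2 (OMR.noStableSubset_psi hθ),
    ?_, ?_⟩, fun θ hθ => ⟨?_, ?_⟩⟩
  · rintro ⟨θ, hθ⟩ ⟨θ', hθ'⟩ h
    obtain ⟨φ, hα, hσ, hr⟩ := Quotient.exact h
    exact Subtype.ext (OMR.eq_of_psi_conj hθ hθ' hα hσ (hr _ (by simp)))
  · rintro ⟨H⟩
    obtain ⟨θ, hθ, φ, hφ, hσ, hα⟩ := OMR.exists_indecomposable_conj
      ((OMR.isPretransitive_closure_pair_iff _ _).1 H.transitive)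
    refine ⟨⟨θ, hθ⟩, (Quotient.sound (s := OMR.rootedSetoid (k + 1)) ?_).symm⟩
    refine ⟨φ, hα.symm, hσ.symm, fun r hr => ?_⟩
    obtain rfl : r = Fin.last k := Fin.ext (by simp; omega)
    exact hφ
  · conv_rhs => rw [← OMR.insertLast_psiAlpha hθ]
    rw [OMR.numCycles_insertLast]
  · rw [← OMR.numCycles_sigmaOne, ← OMR.insertLast_psiSigma hθ, OMR.numCycles_insertLast]
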